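/- Let $\mathcal H$ be a real Hilbert space and let $f:\mathcal H\to\,]-\infty,+\infty]$ be proper, convex and lower semicontinuous, with effective domain $\operatorname{dom} f=\{x: f(x)<+\infty\}$, subdifferential $\partial f$, and conjugate $f^*(u)=\sup_{x\in\mathcal H}\big(\langle x,u\rangle-f(x)\big)$. Suppose that $f$ is Legendre, that is: - $f$ is essentially smooth: $\operatorname{dom}\partial f=\operatorname{int}\operatorname{dom} f\neq\varnothing$, $f$ is Gâteaux differentiable on $\operatorname{int}\operatorname{dom} f$, and $\|\nabla f(x_k)\|\to+\infty$ for every sequence $(x_k)$ in $\operatorname{int}\operatorname{dom} f$ that converges to a boundary point of $\operatorname{dom} f$; and - $f$ is essentially strictly convex: $(\partial f)^{-1}$ is locally bounded on its domain, and $f$ is strictly convex on every convex subset of $\operatorname{dom}\partial f$. For $q\in\operatorname{int}\operatorname{dom} f$ let $D_f(x,q)=f(x)-f(q)-\langle\nabla f(q),x-q\rangle$ be the Bregman distance. Here $\nabla f$ and $\nabla f^*$ denote Gâteaux gradients, and $\nabla f^*(A)$ is the set of all values $\nabla f^*(u)$ at those points $u\in A\cap\operatorname{int}\operatorname{dom}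 f^*$ where $f^*$ is Gâteaux differentiable. Let $\mathcal S$ be a nonempty finite subset of $\operatorname{dom} f$, let $\operatorname{aff}\mathcal S$ be its affine hull, let $M=\operatorname{aff}\mathcal S-\operatorname{aff}\mathcal S$, with orthogonal complement $M^\perp$, and put $$\overrightarrow{E}_f(\mathcal S)=\{q\in\operatorname{int}\operatorname{dom} f:\ D_f(x,q)=D_f(x',q)\text{ for all }x,x'\in\mathcal S\}.$$ The forward Bregman pseudo-circumcenter set of $\mathcal S$ is $\overrightarrow{CC}{}^{ps}_f(\mathcal S)=\nabla f^*(\operatorname{aff}\mathcal S)\cap\overrightarrow{E}_f(\mathcal S)$. Let $y\in\overrightarrow{E}_f(\mathcal S)$. Then the following hold. 1. $\overrightarrow{CC}{}^{ps}_f(\mathcal S)=\nabla f^*(\operatorname{aff}\mathcal S)\cap\operatorname{int}\operatorname{dom} f\cap\nabla f^*\big(\nabla f(y)+M^\perp\big)$. 2. The best approximation $q=\mathrm P_{\operatorname{aff}\mathcal S}(\nabla f(y))$ of $\nabla f(y)$ from $\operatorname{aff}\mathcal S$ exists and is unique. If $q\in\operatorname{int}\operatorname{dom} f^*$ (which is the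 case, for example, if $\operatorname{aff}\mathcal S\subseteq\operatorname{int}\operatorname{dom} f^*$ or $\operatorname{dom} f^*=\mathcal H$), then $f^*$ is Gâteaux differentiable at $q$ and $\overrightarrow{CC}{}^{ps}_f(\mathcal S)=\{\nabla f^*(q)\}$. -/

import Mathlib

open Filter Topology Set
open scoped InnerProductSpace

namespace Bregman

variable {H : Type*} [NormedAddCommGroup H] [InnerProductSpace ℝ H]

/-- The effective domain of an extended-real-valued function. -/
def dom (f : H → EReal) : Set H := {x | f x < ⊤}

/-- The class `Γ₀(H)`: proper, convex (the epigraph is convex) and closed (lower semicontinuous)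
functions with values in `]-∞, +∞]`. -/
structure IsGammaZero (f : H → EReal) : Prop where
  ne_bot : ∀ x, f x ≠ ⊥
  dom_nonempty : (dom f).Nonempty
  convex_epigraph : Convex ℝ {p : H × ℝ | f p.1 ≤ (p.2 : EReal)}
  lsc : LowerSemicontinuous f

/-- The Fenchel conjugate `f*(u) = sup_x (⟪x, u⟫ - f x)`. -/
noncomputable def conj (f : H → EReal) (u : H) : EReal :=
  ⨆ x, (((⟪x, u⟫_ℝ : ℝ) : EReal) - f x)

/-- The convex subdifferential `∂f(x)`. -/
def subdiff (f : H → EReal) (x : H) : Set H :=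
  {u | ∀ z, ((⟪z - x, u⟫_ℝ : ℝ) : EReal) + f x ≤ f z}

/-- The domain of the set-valued operator `∂f`. -/
def domSubdiff (f : H → EReal) : Set H := {x | (subdiff f x).Nonempty}

/-- `g` is the Gâteaux gradient of `f` at the point `x` of the interior of the domain of `f`
(near such a point, along every line, `f` is real-valued when it never takes the value `-∞`). -/
def HasGateauxGradientAt (f : H → EReal) (x g : H) : Prop :=
  x ∈ interior (dom f) ∧ ∀ v, HasLineDerivAt ℝ (fun z => (f z).toReal) ⟪g, v⟫_ℝ x v

/-- Gâteaux differentiability at a point of the interior of the domain. -/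
def GateauxDifferentiableAt (f : H → EReal) (x : H) : Prop :=
  ∃ g, HasGateauxGradientAt f x g

open Classical in
/-- The Gâteaux gradient `∇f(x)`; the value is only meaningful at points of
Gâteaux differentiability. -/
noncomputable def grad (f : H → EReal) (x : H) : H :=
  if h : GateauxDifferentiableAt f x then h.choose else 0

/-- The image `∇f(A)` of a set under the gradient mapping, regarded as a partial mapping that is
defined exactly at the points of Gâteaux differentiability. -/
def gradImage (f : H → EReal) (A : Set H) : Set H :=
  grad f '' (A ∩ {x | GateauxDifferentiableAt f x})

structure IsEssentiallySmooth (f : H → EReal) : Prop where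
  domSubdiff_eq : domSubdiff f = interior (dom f)
  interior_nonempty : (interior (dom f)).Nonempty
  differentiable : ∀ x ∈ interior (dom f), GateauxDifferentiableAt f x
  norm_grad_tendsto : ∀ (x : ℕ → H) (a : H), (∀ k, x k ∈ interior (dom f)) →
    a ∈ frontier (dom f) → Tendsto x atTop (𝓝 a) →
    Tendsto (fun k => ‖grad f (x k)‖) atTop atTop

structure IsEssentiallyStrictlyConvex (f : H → EReal) : Prop where
  /-- The inverse of `∂f` is locally bounded at every point `u` of its domain. -/
  locally_bounded_inv : ∀ u, (∃ x, u ∈ subdiff f x) →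
    ∃ δ > 0, Bornology.IsBounded {x | ∃ v ∈ Metric.closedBall u δ, v ∈ subdiff f x}
  /-- `f` (which is finite where `∂f` is nonempty) is strictly convex on every convex subset of
  the domain of `∂f`. -/
  strictConvexOn : ∀ C ⊆ domSubdiff f, Convex ℝ C → StrictConvexOn ℝ C (fun x => (f x).toReal)

/-- Legendre functions. -/
structure IsLegendre (f : H → EReal) : Prop where
  gammaZero : IsGammaZero f
  smooth : IsEssentiallySmooth f
  strict : IsEssentiallyStrictlyConvex f

open Classical in
/-- The Bregman distance `D_f(x, y)`. -/
noncomputable def dist (f : H → EReal) (x y : H) : EReal :=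
  if y ∈ interior (dom f) then f x - f y - ((⟪grad f y, x - y⟫_ℝ : ℝ) : EReal) else ⊤

/-- The set of all `q` in the interior of the domain of `f` such that `D_f(x, q)` is the same
for all `x ∈ K`. -/
def forwardE (f : H → EReal) (K : Set H) : Set H :=
  {q | q ∈ interior (dom f) ∧ ∀ x ∈ K, ∀ x' ∈ K, dist f x q = dist f x' q}

/-- The (set-valued) forward Bregman pseudo-circumcenter operator. -/
def forwardPseudoCircumcenter (f : H → EReal) (K : Set H) : Set H :=
  gradImage (conj f) (affineSpan ℝ K : Set H) ∩ forwardE f K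

/-- The set of best approximations to `x` from `C` (the set-valued projector onto `C`). -/
def bestApprox (C : Set H) (x : H) : Set H :=
  {p | p ∈ C ∧ ∀ c ∈ C, ‖x - p‖ ≤ ‖x - c‖}

end Bregman

/-!
Both statements rest on the inversion of `∇f` by `∇f*`. If `p = ∇f*(u)`, then `p ∈ ∂f*(u)`, hence
`u ∈ ∂f(p)` by half of the Fenchel–Moreau theorem (`mem_subdiff_of_mem_subdiff_conj`). Essential
smoothness puts `p` in the interior of `dom f` and gives `u = ∇f(p)`. So `p ∈ ∇f*(A)` exactly when
`∇f(p) ∈ A` and `∇f*` is defined at `∇f(p)` with value `p` (`IsLegendre.mem_gradImage_conj_iff`).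

On the other side, the Bregman distances from `p` to `x` and `x'` agree if and only if
`f x - f x' = ⟪∇f(p), x - x'⟫`. Comparison with `y` turns membership in `forwardE` into
`∇f(p) - ∇f(y) ∈ M^⊥`, with `M` the direction of `aff S` (`mem_forwardE_iff`). The two facts give
the first statement, and they describe the pseudo-circumcenters as the values of `∇f*` on
`aff S ∩ (∇f(y) + M^⊥)`. This intersection is the single point `q`, the orthogonal projection of
`∇f(y)` onto `aff S`.

It remains to differentiate `f*` at `q` when `q` lies in the interior of `dom f*`
(`IsLegendre.gateauxDifferentiableAt_conj`). Strict convexity of `f` makes `(∂f)⁻¹` single-valued,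
so `f*` has at most one subgradient at `q`. The conjugate is lower semicontinuous, hence continuous
on the interior of its domain by Baire's theorem, and Hahn–Banach then realises both one-sided
directional derivatives by subgradients; these coincide, so the one-sided derivatives do too.
-/

namespace Bregman

section
variable {H : Type*} [NormedAddCommGroup H] [InnerProductSpace ℝ H] {f : H → EReal}

/-! ### Real-valued restrictions of functions in `Γ₀` -/

theorem IsGammaZero.coe_toReal (hf : IsGammaZero f) {x : H} (hx : x ∈ dom f) :
    ((f x).toReal : EReal) = f x :=
  EReal.coe_toReal (ne_of_lt hx) (hf.ne_bot x)

theorem IsGammaZero.convexOn (hf : IsGammaZero f) :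
    ConvexOn ℝ (dom f) (fun x => (f x).toReal) := by
  have key : ∀ x ∈ dom f, ∀ y ∈ dom f, ∀ a b : ℝ, 0 ≤ a → 0 ≤ b → a + b = 1 →
      f (a • x + b • y) ≤ ((a * (f x).toReal + b * (f y).toReal : ℝ) : EReal) := by
    intro x hx y hy a b ha hb hab
    have := hf.convex_epigraph (x := (x, (f x).toReal)) (y := (y, (f y).toReal))
      (hf.coe_toReal hx).ge (hf.coe_toReal hy).ge ha hb hab
    simpa using this
  refine ⟨fun x hx y hy a b ha hb hab =>
    (key x hx y hy a b ha hb hab).trans_lt (EReal.coe_lt_top _), ?_⟩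
  intro x hx y hy a b ha hb hab
  exact EReal.toReal_le_toReal (key x hx y hy a b ha hb hab) (hf.ne_bot _) (EReal.coe_ne_top _)

theorem IsGammaZero.isClosed_epigraph (hf : IsGammaZero f) :
    IsClosed {p : H × ℝ | f p.1 ≤ (p.2 : EReal)} :=
  hf.lsc.isClosed_epigraph.preimage
    (continuous_fst.prodMk (continuous_coe_real_ereal.comp continuous_snd))

theorem IsGammaZero.mem_subdiff_iff (hf : IsGammaZero f) {x u : H} :
    u ∈ subdiff f x ↔
      x ∈ dom f ∧ ∀ z ∈ dom f, ⟪z - x, u⟫_ℝ + (f x).toReal ≤ (f z).toReal := by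
  constructor
  · intro h
    have hx : x ∈ dom f := by
      obtain ⟨z, hz⟩ := hf.dom_nonempty
      have := (h z).trans_lt hz
      by_contra hx
      rw [dom, mem_ofPred_eq, not_lt_top_iff] at hx
      simp [hx] at this
    refine ⟨hx, fun z hz => ?_⟩
    have := h z
    rw [← hf.coe_toReal hx, ← hf.coe_toReal hz] at this
    exact_mod_cast this
  · rintro ⟨hx, h⟩ z
    by_cases hz : z ∈ dom f
    · rw [← hf.coe_toReal hx, ← hf.coe_toReal hz]
      exact_mod_cast h z hz
    · rw [dom, mem_ofPred_eq, not_lt_top_iff] at hz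
      simp [hz]

/-! ### Gâteaux gradients and subgradients -/

theorem eventually_add_smul_mem {U : Set H} {x : H} (hU : U ∈ 𝓝 x) (v : H) :
    ∀ᶠ t : ℝ in 𝓝 0, x + t • v ∈ U :=
  (Continuous.tendsto' (by fun_prop) 0 x (by simp) : Tendsto (fun t : ℝ => x + t • v) _ _) hU

theorem HasGateauxGradientAt.unique {x g g' : H} (h : HasGateauxGradientAt f x g)
    (h' : HasGateauxGradientAt f x g') : g = g' :=
  ext_inner_right ℝ fun v => (h.2 v).unique (h'.2 v)

theorem GateauxDifferentiableAt.hasGateauxGradientAt {x : H} (h : GateauxDifferentiableAt f x) :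
    HasGateauxGradientAt f x (grad f x) := by
  rw [grad, dif_pos h]
  exact h.choose_spec

theorem HasGateauxGradientAt.mem_subdiff (hf : IsGammaZero f) {x g : H}
    (h : HasGateauxGradientAt f x g) : g ∈ subdiff f x := by
  have hx := interior_subset h.1
  refine hf.mem_subdiff_iff.2 ⟨hx, fun z hz => ?_⟩
  have hd := (h.2 (z - x)).tendsto_slope_zero_right
  have hle : ⟪g, z - x⟫_ℝ ≤ (f z).toReal - (f x).toReal := by
    refine le_of_tendsto hd ?_
    filter_upwards [Ioo_mem_nhdsGT (zero_lt_one' ℝ)] with t ht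
    have hc := hf.convexOn.2 hx hz (sub_nonneg.2 ht.2.le) ht.1.le (sub_add_cancel 1 t)
    have he : (1 - t) • x + t • z = x + t • (z - x) := by module
    rw [he] at hc
    simp only [smul_eq_mul] at hc
    rw [smul_eq_mul, inv_mul_le_iff₀ ht.1]
    linarith
  rw [real_inner_comm]
  linarith

theorem HasGateauxGradientAt.eq_of_mem_subdiff (hf : IsGammaZero f) {x g u : H}
    (h : HasGateauxGradientAt f x g) (hu : u ∈ subdiff f x) : u = g := by
  refine ext_inner_right ℝ fun v => ?_
  have hnear := eventually_add_smul_mem (mem_interior_iff_mem_nhds.1 h.1) v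
  have hd : HasDerivAt (fun t : ℝ => (f (x + t • v)).toReal - t * ⟪u, v⟫_ℝ)
      (⟪g, v⟫_ℝ - 1 * ⟪u, v⟫_ℝ) 0 :=
    HasDerivAt.sub (h.2 v) ((hasDerivAt_id 0).mul_const _)
  have hmin : IsLocalMin (fun t : ℝ => (f (x + t • v)).toReal - t * ⟪u, v⟫_ℝ) 0 := by
    filter_upwards [hnear] with t ht
    have := (hf.mem_subdiff_iff.1 hu).2 _ ht
    rw [add_sub_cancel_left, real_inner_smul_left, real_inner_comm] at this
    simp only [zero_smul, add_zero, zero_mul, sub_zero]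
    linarith
  have := hmin.hasDerivAt_eq_zero hd
  linarith

/-! ### The conjugate -/

theorem conj_le_coe_iff {u : H} {c : ℝ} :
    conj f u ≤ (c : EReal) ↔ ∀ x, ((⟪x, u⟫_ℝ - c : ℝ) : EReal) ≤ f x := by
  rw [conj, iSup_le_iff]
  refine forall_congr' fun x => ?_
  induction h : f x with
  | bot => simp [-EReal.coe_sub]
  | top => simp
  | coe r =>
    norm_cast
    constructor <;> intro h <;> linarith

theorem conj_ne_bot (hf : IsGammaZero f) (u : H) : conj f u ≠ ⊥ := by
  obtain ⟨x, hx⟩ := hf.dom_nonempty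
  have h := le_iSup (fun x => (((⟪x, u⟫_ℝ : ℝ) : EReal) - f x)) x
  rw [← hf.coe_toReal hx, ← EReal.coe_sub] at h
  exact ((EReal.bot_lt_coe _).trans_le h).ne'

theorem isGammaZero_conj (hf : IsGammaZero f) (hne : (dom (conj f)).Nonempty) :
    IsGammaZero (conj f) where
  ne_bot := conj_ne_bot hf
  dom_nonempty := hne
  convex_epigraph := by
    rintro ⟨u, r⟩ hu ⟨v, s⟩ hv a b ha hb hab
    simp only [mem_ofPred_eq, conj_le_coe_iff] at hu hv ⊢
    intro x
    have hm : ((max (⟪x, u⟫_ℝ - r) (⟪x, v⟫_ℝ - s) : ℝ) : EReal) ≤ f x := by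
      rcases max_choice (⟪x, u⟫_ℝ - r) (⟪x, v⟫_ℝ - s) with h | h <;> rw [h]
      exacts [hu x, hv x]
    refine le_trans (EReal.coe_le_coe ?_) hm
    have h := Convex.min_le_combo (-(⟪x, u⟫_ℝ - r)) (-(⟪x, v⟫_ℝ - s)) ha hb hab
    simp only [Prod.smul_mk, Prod.mk_add_mk, inner_add_right, real_inner_smul_right, smul_eq_mul,
      min_neg_neg] at h ⊢
    linarith
  lsc := by
    refine lowerSemicontinuous_iff_isClosed_preimage.2 fun c => ?_
    induction c with
    | bot =>
      convert isClosed_empty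
      ext u
      simpa using conj_ne_bot hf u
    | top => simp
    | coe r =>
      have : conj f ⁻¹' Iic (r : EReal) = ⋂ x, {u | ((⟪x, u⟫_ℝ - r : ℝ) : EReal) ≤ f x} := by
        ext u
        simp [conj_le_coe_iff]
      rw [this]
      refine isClosed_iInter fun x => isClosed_le ?_ continuous_const
      exact continuous_coe_real_ereal.comp (by fun_prop)

variable [CompleteSpace H]

theorem exists_eq_inner_add_mul (L : StrongDual ℝ (H × ℝ)) :
    ∃ (a : H) (β : ℝ), ∀ z t, L (z, t) = ⟪z, a⟫_ℝ + β * t := by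
  refine ⟨(InnerProductSpace.toDual ℝ H).symm (L.comp (ContinuousLinearMap.inl ℝ H ℝ)),
    L (0, 1), fun z t => ?_⟩
  rw [real_inner_comm, InnerProductSpace.toDual_symm_apply]
  have : ((z, t) : H × ℝ) = (z, 0) + t • (0, 1) := by simp
  rw [this, map_add, map_smul]
  simp [mul_comm]

/-- Half of the Fenchel–Moreau theorem, in the form `∂f* ⊆ (∂f)⁻¹`. If `f p` exceeded
`s = ⟪p, u⟫ - f*(u)`, a hyperplane would separate `(p, s)` from the epigraph of `f` and yield an
affine minorant of `f` whose value at `p` exceeds `s`; its slope `a` then contradicts the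
subgradient inequality for `f*` between `u` and `a`. -/
theorem mem_subdiff_of_mem_subdiff_conj (hf : IsGammaZero f) {u p : H}
    (hp : p ∈ subdiff (conj f) u) (hu : u ∈ dom (conj f)) : u ∈ subdiff f p := by
  have hg := isGammaZero_conj hf ⟨u, hu⟩
  set c := (conj f u).toReal with hc
  have hcu : (c : EReal) = conj f u := hg.coe_toReal hu
  have hyoung : ∀ z, ((⟪z, u⟫_ℝ - c : ℝ) : EReal) ≤ f z := conj_le_coe_iff.1 hcu.ge
  -- Every affine minorant of `f` is at most `⟪p, u⟫ - f*(u)` at `p`.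
  have hminor : ∀ (a : H) (b : ℝ), (∀ z ∈ dom f, ⟪z, a⟫_ℝ + b ≤ (f z).toReal) →
      ⟪p, a⟫_ℝ + b ≤ ⟪p, u⟫_ℝ - c := by
    intro a b hab
    have ha : conj f a ≤ ((-b : ℝ) : EReal) := by
      refine conj_le_coe_iff.2 fun z => ?_
      by_cases hz : z ∈ dom f
      · rw [← hf.coe_toReal hz, EReal.coe_le_coe_iff, sub_neg_eq_add]
        exact hab z hz
      · rw [dom, mem_ofPred_eq, not_lt_top_iff] at hz
        simp [hz]
    have h := (hp a).trans ha
    rw [← hcu, ← EReal.coe_add, EReal.coe_le_coe_iff, inner_sub_left, real_inner_comm,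
      real_inner_comm p u] at h
    linarith
  have hfp : f p ≤ ((⟪p, u⟫_ℝ - c : ℝ) : EReal) := by
    by_contra hlt
    obtain ⟨L, k, hk, hL⟩ := geometric_hahn_banach_point_closed hf.convex_epigraph
      hf.isClosed_epigraph (x := (p, ⟪p, u⟫_ℝ - c)) hlt
    obtain ⟨a, β, haβ⟩ := exists_eq_inner_add_mul L
    rw [haβ] at hk
    have hL' : ∀ z ∈ dom f, ∀ t, (f z).toReal ≤ t → k < ⟪z, a⟫_ℝ + β * t := by
      intro z hz t ht
      rw [← haβ]
      refine hL (z, t) ?_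
      rw [mem_ofPred_eq, ← hf.coe_toReal hz, EReal.coe_le_coe_iff]
      exact ht
    have hβ : 0 ≤ β := by
      by_contra! hβ
      obtain ⟨z, hz⟩ := hf.dom_nonempty
      have h := hL' z hz (max (f z).toReal ((k - ⟪z, a⟫_ℝ) / β)) (le_max_left _ _)
      have h2 := mul_le_mul_of_nonpos_left
        (le_max_right (f z).toReal ((k - ⟪z, a⟫_ℝ) / β)) hβ.le
      rw [mul_div_cancel₀ _ hβ.ne] at h2
      linarith
    rcases hβ.eq_or_lt with rfl | hβ
    · -- A vertical hyperplane is tilted by adding it to the minorant `⟪·, u⟫ - f*(u)`.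
      have h := hminor (u - a) (k - c) fun z hz => by
        have h1 := hyoung z
        rw [← hf.coe_toReal hz, EReal.coe_le_coe_iff] at h1
        have h2 := hL' z hz _ le_rfl
        rw [inner_sub_right]
        linarith
      rw [inner_sub_right] at h
      linarith
    · have h := hminor (-β⁻¹ • a) (β⁻¹ * k) fun z hz => by
        have h2 := hL' z hz _ le_rfl
        rw [real_inner_smul_right]
        have h3 : β⁻¹ * (k - ⟪z, a⟫_ℝ) ≤ (f z).toReal := by
          rw [inv_mul_le_iff₀ hβ]
          linarith
        linarith
      rw [real_inner_smul_right] at h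
      have h3 : ⟪p, u⟫_ℝ - c < β⁻¹ * (k - ⟪p, a⟫_ℝ) := by
        rw [lt_inv_mul_iff₀ hβ]
        linarith
      linarith
  intro z
  refine le_trans (add_le_add_right hfp _) (le_trans ?_ (hyoung z))
  rw [← EReal.coe_add, EReal.coe_le_coe_iff, inner_sub_left]
  linarith

end

section
variable {H : Type*} [NormedAddCommGroup H] [InnerProductSpace ℝ H] [CompleteSpace H]
  {f : H → EReal}

/-! ### Continuity and subgradients in the interior of the domain -/

/-- By Baire's theorem, some sublevel set of a function in `Γ₀` has an interior point in the
interior of the domain, and a convex function bounded above near one point of an open convex set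
is continuous on that set. -/
theorem IsGammaZero.continuousOn_interior (hf : IsGammaZero f)
    (hne : (interior (dom f)).Nonempty) :
    ContinuousOn (fun x => (f x).toReal) (interior (dom f)) := by
  have hconv : ConvexOn ℝ (interior (dom f)) (fun x => (f x).toReal) :=
    hf.convexOn.subset interior_subset hf.convexOn.1.interior
  let A : Option ℕ → Set H := fun o =>
    o.elim (interior (dom f))ᶜ fun n => f ⁻¹' Iic ((n : ℝ) : EReal)
  have hA : ∀ o, IsClosed (A o) := by
    rintro (_ | n)
    · exact isOpen_interior.isClosed_compl
    · exact hf.lsc.isClosed_preimage _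
  have hcov : ⋃ o, A o = univ := by
    refine eq_univ_of_forall fun x => mem_iUnion.2 ?_
    by_cases hx : x ∈ interior (dom f)
    · obtain ⟨n, hn⟩ := exists_nat_ge (f x).toReal
      refine ⟨some n, ?_⟩
      change f x ≤ ((n : ℝ) : EReal)
      rw [← hf.coe_toReal (interior_subset hx)]
      exact_mod_cast hn
    · exact ⟨none, hx⟩
  obtain ⟨x, hx, hxA⟩ :=
    (dense_iUnion_interior_of_closed hA hcov).inter_open_nonempty _ isOpen_interior hne
  obtain ⟨o, ho⟩ := mem_iUnion.1 hxA
  have hbdd : ∃ x ∈ interior (dom f), (𝓝 x).IsBoundedUnder (· ≤ ·) fun x => (f x).toReal := by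
    refine ⟨x, hx, ?_⟩
    rcases o with _ | n
    · exact absurd hx (interior_subset ho)
    · refine ⟨n, ?_⟩
      rw [eventually_map]
      filter_upwards [mem_interior_iff_mem_nhds.1 ho] with z hz
      exact EReal.toReal_le_toReal hz (hf.ne_bot z) (EReal.coe_ne_top _)
  exact ((hconv.continuousOn_tfae isOpen_interior hne).out 3 1).1 hbdd

/-- Hahn–Banach: a slope `r` supporting `f` at `q` along the line `q + ℝ v` is realised by a
subgradient. The functional separates the open strict epigraph over the interior of the domain
from the line of slope `r` through `(q, f q)`. -/
theorem IsGammaZero.exists_mem_subdiff_inner_eq (hf : IsGammaZero f) {q v : H} {r : ℝ}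
    (hq : q ∈ interior (dom f))
    (hr : ∀ t : ℝ, q + t • v ∈ interior (dom f) →
      (f q).toReal + t * r ≤ (f (q + t • v)).toReal) :
    ∃ p ∈ subdiff f q, ⟪p, v⟫_ℝ = r := by
  set U := interior (dom f)
  set F : H → ℝ := fun x => (f x).toReal
  have hconv : ConvexOn ℝ U F := hf.convexOn.subset interior_subset hf.convexOn.1.interior
  have hcont : ContinuousOn F U := hf.continuousOn_interior ⟨q, hq⟩
  have hopen : IsOpen {w : H × ℝ | w.1 ∈ U ∧ F w.1 < w.2} := by
    have hU : IsOpen {w : H × ℝ | w.1 ∈ U} := isOpen_interior.preimage continuous_fst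
    have h : ContinuousOn (fun w : H × ℝ => w.2 - F w.1) {w : H × ℝ | w.1 ∈ U} :=
      continuousOn_snd.sub (hcont.comp continuousOn_fst fun _ h => h)
    convert h.isOpen_inter_preimage hU (isOpen_Ioi (a := (0 : ℝ))) using 1
    ext w
    simp
  let ℓ : ℝ →ᵃ[ℝ] H × ℝ := AffineMap.lineMap (q, F q) (q + v, F q + r)
  have hℓ : ∀ t, ℓ t = (q + t • v, F q + t * r) := by
    intro t
    simp [ℓ, AffineMap.lineMap_apply, add_comm]
  obtain ⟨L, k, hk, hk'⟩ := geometric_hahn_banach_open hconv.convex_strict_epigraph hopen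
    (convex_univ.affine_image ℓ) (by
      rw [disjoint_left]
      rintro w ⟨hw, hlt⟩ ⟨t, -, rfl⟩
      rw [hℓ] at hw hlt
      exact (hr t hw).not_gt hlt)
  obtain ⟨a, β, hL⟩ := exists_eq_inner_add_mul L
  have hs : ∀ z ∈ U, ∀ t, F z < t → ⟪z, a⟫_ℝ + β * t < k := fun z hz t ht => by
    rw [← hL]
    exact hk (z, t) ⟨hz, ht⟩
  have hl : ∀ t : ℝ, k ≤ ⟪q, a⟫_ℝ + β * F q + t * (⟪v, a⟫_ℝ + β * r) := fun t => by
    have h := hk' _ ⟨t, mem_univ t, rfl⟩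
    rw [hℓ, hL, inner_add_left, real_inner_smul_left] at h
    linarith
  have hk0 : k ≤ ⟪q, a⟫_ℝ + β * F q := by simpa using hl 0
  have hβ : β < 0 := by
    have := hs q hq (F q + 1) (by linarith)
    linarith
  have hz0 : ⟪v, a⟫_ℝ + β * r = 0 := by
    by_contra hne
    have := hl ((k - 1 - (⟪q, a⟫_ℝ + β * F q)) / (⟪v, a⟫_ℝ + β * r))
    rw [div_mul_cancel₀ _ hne] at this
    linarith
  have hsub : ∀ z ∈ U, ⟪z - q, -β⁻¹ • a⟫_ℝ + F q ≤ F z := by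
    intro z hz
    refine le_of_forall_gt_imp_ge_of_dense fun t ht => ?_
    have h := hs z hz t ht
    have h2 : β * (t - F q) ≤ -⟪z - q, a⟫_ℝ := by
      rw [inner_sub_left]
      linarith
    rw [real_inner_smul_right]
    have h3 := mul_le_mul_of_nonpos_left h2 (inv_nonpos.2 hβ.le)
    rw [inv_mul_cancel_left₀ hβ.ne] at h3
    linarith
  refine ⟨-β⁻¹ • a, hf.mem_subdiff_iff.2 ⟨interior_subset hq, fun z hz => ?_⟩, ?_⟩
  · -- The inequality extends from `U` to the domain along the segment from `q` to `z`.
    have hev := eventually_add_smul_mem (isOpen_interior.mem_nhds hq) (z - q)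
    obtain ⟨t, ht0, htU, ht1⟩ :=
      (hev.and (eventually_lt_nhds (zero_lt_one' ℝ))).exists_gt
    have h1 := hsub _ htU
    have h2 := hf.convexOn.2 (interior_subset hq) hz (sub_nonneg.2 ht1.le) ht0.le
      (sub_add_cancel 1 t)
    have he : (1 - t) • q + t • z = q + t • (z - q) := by module
    rw [he] at h2
    rw [add_sub_cancel_left, real_inner_smul_left] at h1
    simp only [smul_eq_mul] at h2
    refine le_of_mul_le_mul_left ?_ ht0
    simp only [F] at h1 ⊢
    linarith
  · rw [real_inner_smul_left, real_inner_comm, eq_neg_of_add_eq_zero_left hz0]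
    rw [neg_mul_neg, inv_mul_cancel_left₀ hβ.ne]

/-- In the interior of the domain, every number between the left and the right directional
derivative in the direction `v` is attained as `⟪p, v⟫` by a subgradient `p`; a single
subgradient therefore makes the one-sided derivatives agree. -/
theorem IsGammaZero.exists_hasGateauxGradientAt (hf : IsGammaZero f) {q : H}
    (hq : q ∈ interior (dom f)) (huniq : (subdiff f q).Subsingleton) :
    ∃ p ∈ subdiff f q, HasGateauxGradientAt f q p := by
  set U := interior (dom f)
  have hconv : ConvexOn ℝ U (fun x => (f x).toReal) :=
    hf.convexOn.subset interior_subset hf.convexOn.1.interior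
  obtain ⟨p, hp, -⟩ := hf.exists_mem_subdiff_inner_eq (v := 0) (r := 0) hq (by simp)
  refine ⟨p, hp, hq, fun v => ?_⟩
  let ℓ : ℝ →ᵃ[ℝ] H := AffineMap.lineMap q (q + v)
  have hℓ : ∀ t, ℓ t = q + t • v := fun t => by simp [ℓ, AffineMap.lineMap_apply, add_comm]
  set S : Set ℝ := ℓ ⁻¹' U
  set φ : ℝ → ℝ := fun t => (f (q + t • v)).toReal with hφ
  have hφc : ConvexOn ℝ S φ := by
    have h : (fun x => (f x).toReal) ∘ ℓ = φ := funext fun t => by simp [hφ, hℓ]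
    exact h ▸ hconv.comp_affineMap ℓ
  have hℓc : Continuous ℓ := by
    have : (ℓ : ℝ → H) = fun t => q + t • v := funext hℓ
    rw [this]
    fun_prop
  have hS : IsOpen S := isOpen_interior.preimage hℓc
  have h0 : (0 : ℝ) ∈ S := by simpa [S, hℓ] using hq
  have h0' : (0 : ℝ) ∈ interior S := by rwa [hS.interior_eq]
  have hlr := hφc.leftDeriv_le_rightDeriv_of_mem_interior h0'
  have hmid : ∀ r, derivWithin φ (Iio 0) 0 ≤ r → r ≤ derivWithin φ (Ioi 0) 0 →
      r = ⟪p, v⟫_ℝ := by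
    intro r hl hr
    obtain ⟨p', hp', h⟩ := hf.exists_mem_subdiff_inner_eq (v := v) (r := r) hq (by
      intro t ht
      have htS : t ∈ S := by simpa [S, hℓ] using ht
      have hφ0 : φ 0 = (f q).toReal := by simp [hφ]
      change _ ≤ φ t
      rw [← hφ0]
      rcases lt_trichotomy t 0 with h | rfl | h
      · have := (hφc.slope_le_leftDeriv_of_mem_interior htS h0' h).trans hl
        rw [slope_def_field, div_le_iff₀ (by linarith)] at this
        linarith
      · simp
      · have := hr.trans (hφc.rightDeriv_le_slope_of_mem_interior h0' htS h)
        rw [slope_def_field, le_div_iff₀ (by linarith)] at this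
        linarith)
    rw [← h, huniq hp' hp]
  have hL := hφc.hasDerivWithinAt_leftDeriv_of_mem_interior h0'
  have hR := hφc.hasDerivWithinAt_rightDeriv_of_mem_interior h0'
  rw [hmid _ le_rfl hlr] at hL
  rw [hmid _ hlr le_rfl] at hR
  have h := hL.Iic_of_Iio.union hR.Ici_of_Ioi
  rwa [Iic_union_Ici, hasDerivWithinAt_univ] at h

end

/-! ### Legendre functions and their conjugates -/

section
variable {H : Type*} [NormedAddCommGroup H] [InnerProductSpace ℝ H] {f : H → EReal}

theorem IsLegendre.hasGateauxGradientAt_of_mem_subdiff (hf : IsLegendre f) {x u : H}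
    (hu : u ∈ subdiff f x) : HasGateauxGradientAt f x u := by
  have hx : x ∈ interior (dom f) := hf.smooth.domSubdiff_eq ▸ ⟨u, hu⟩
  have h := (hf.smooth.differentiable x hx).hasGateauxGradientAt
  rwa [← h.eq_of_mem_subdiff hf.gammaZero hu] at h

theorem HasGateauxGradientAt.grad_eq {x g : H} (h : HasGateauxGradientAt f x g) :
    grad f x = g :=
  GateauxDifferentiableAt.hasGateauxGradientAt ⟨g, h⟩ |>.unique h

/-- Points with a common subgradient form a convex set on which `f` is affine, so strict convexity
makes `(∂f)⁻¹` single-valued. -/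
theorem IsLegendre.eq_of_mem_subdiff (hf : IsLegendre f) {x x' u : H} (hx : u ∈ subdiff f x)
    (hx' : u ∈ subdiff f x') : x = x' := by
  have hmem : ∀ {z}, u ∈ subdiff f z ↔ _ := hf.gammaZero.mem_subdiff_iff
  obtain ⟨hxd, hxs⟩ := hmem.1 hx
  obtain ⟨hxd', hxs'⟩ := hmem.1 hx'
  have hseg : ∀ z ∈ segment ℝ x x', u ∈ subdiff f z := by
    rintro _ ⟨a, b, ha, hb, hab, rfl⟩
    refine hmem.2 ⟨hf.gammaZero.convexOn.1 hxd hxd' ha hb hab, fun z hz => ?_⟩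
    have h := hf.gammaZero.convexOn.2 hxd hxd' ha hb hab
    have h1 := mul_le_mul_of_nonneg_left (hxs z hz) ha
    have h2 := mul_le_mul_of_nonneg_left (hxs' z hz) hb
    have h3 : a * (f z).toReal + b * (f z).toReal = (f z).toReal := by
      rw [← add_mul, hab, one_mul]
    have h4 : a * ⟪z, u⟫_ℝ + b * ⟪z, u⟫_ℝ = ⟪z, u⟫_ℝ := by rw [← add_mul, hab, one_mul]
    simp only [inner_sub_left, inner_add_left, real_inner_smul_left, smul_eq_mul] at h h1 h2 ⊢
    linarith
  by_contra hne
  have hs := (hf.strict.strictConvexOn (segment ℝ x x') (fun z hz => ⟨u, hseg z hz⟩)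
    (convex_segment x x')).2 (left_mem_segment ℝ x x') (right_mem_segment ℝ x x') hne
    (half_pos one_pos) (half_pos one_pos) (add_halves 1)
  have hd := hf.gammaZero.convexOn.1 hxd hxd' (half_pos one_pos).le (half_pos one_pos).le
    (add_halves (1 : ℝ))
  have h1 := hxs _ hd
  have h2 := hxs' _ hd
  simp only [inner_sub_left, inner_add_left, real_inner_smul_left, smul_eq_mul] at hs h1 h2
  linarith

/-- Membership in `forwardE` compares `∇f(q)` with `∇f(y)`: equality of the Bregman distances at
`q` reads `f x - f x' = ⟪∇f(q), x - x'⟫`, whose left-hand side does not depend on `q`. -/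
theorem mem_forwardE_iff (hf : IsGammaZero f) {S : Set H} (hS : S ⊆ dom f) {y q : H}
    (hy : y ∈ forwardE f S) (hq : q ∈ interior (dom f)) :
    q ∈ forwardE f S ↔ grad f q - grad f y ∈ (affineSpan ℝ S).directionᗮ := by
  have hdist : ∀ p ∈ interior (dom f), ∀ x ∈ S, ∀ x' ∈ S, dist f x p = dist f x' p ↔
      (f x).toReal - (f x').toReal = ⟪grad f p, x - x'⟫_ℝ := by
    intro p hp x hx x' hx'
    rw [dist, dist, if_pos hp, if_pos hp, ← hf.coe_toReal (hS hx), ← hf.coe_toReal (hS hx'),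
      ← hf.coe_toReal (interior_subset hp)]
    norm_cast
    simp only [EReal.toReal_coe, inner_sub_right]
    constructor <;> intro h <;> linarith
  rw [direction_affineSpan, vectorSpan_def, Submodule.mem_orthogonal']
  constructor
  · intro h v hv
    induction hv using Submodule.span_induction with
    | mem v hv =>
      obtain ⟨x, hx, x', hx', rfl⟩ := hv
      have h1 := (hdist q hq x hx x' hx').1 (h.2 x hx x' hx')
      have h2 := (hdist y hy.1 x hx x' hx').1 (hy.2 x hx x' hx')
      change ⟪grad f q - grad f y, x - x'⟫_ℝ = 0
      rw [inner_sub_left, ← h1, ← h2, sub_self]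
    | zero => simp
    | add v w _ _ hv hw => rw [inner_add_right, hv, hw, add_zero]
    | smul c v _ hv => rw [real_inner_smul_right, hv, mul_zero]
  · refine fun h => ⟨hq, fun x hx x' hx' => (hdist q hq x hx x' hx').2 ?_⟩
    have h1 := h (x - x') (Submodule.subset_span ⟨x, hx, x', hx', rfl⟩)
    rw [inner_sub_left] at h1
    rw [(hdist y hy.1 x hx x' hx').1 (hy.2 x hx x' hx')]
    linarith

/-- If `x - q` is orthogonal to the direction of `A`, then `q ∈ A` is the only best approximation
of `x` from `A`, by Pythagoras. -/
theorem bestApprox_eq_singleton {A : AffineSubspace ℝ H} {x q : H} (hq : q ∈ A)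
    (horth : x - q ∈ A.directionᗮ) : bestApprox (A : Set H) x = {q} := by
  have hpyth : ∀ c ∈ A, ‖x - c‖ * ‖x - c‖ = ‖x - q‖ * ‖x - q‖ + ‖q - c‖ * ‖q - c‖ := by
    intro c hc
    have h := norm_add_sq_eq_norm_sq_add_norm_sq_real
      (Submodule.inner_left_of_mem_orthogonal (A.vsub_mem_direction hq hc) horth)
    rwa [vsub_eq_sub, sub_add_sub_cancel] at h
  ext c
  constructor
  · rintro ⟨hc, hle⟩
    have h1 := hpyth c hc
    have h2 := mul_self_le_mul_self (norm_nonneg _) (hle q hq)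
    have h3 : ‖q - c‖ = 0 := mul_self_eq_zero.1
      (le_antisymm (by linarith) (mul_self_nonneg _))
    exact (sub_eq_zero.1 (norm_eq_zero.1 h3)).symm
  · rintro rfl
    refine ⟨hq, fun d hd => nonneg_le_nonneg_of_sq_le_sq (norm_nonneg _) ?_⟩
    rw [hpyth d hd]
    exact le_add_of_nonneg_right (mul_self_nonneg _)

variable [CompleteSpace H]

/-- Wherever `∇f*(u)` exists, it is inverted by `∇f`. -/
theorem IsLegendre.hasGateauxGradientAt_of_conj (hf : IsLegendre f) {u p : H}
    (h : HasGateauxGradientAt (conj f) u p) : HasGateauxGradientAt f p u := by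
  have hu := interior_subset h.1
  exact hf.hasGateauxGradientAt_of_mem_subdiff (mem_subdiff_of_mem_subdiff_conj hf.gammaZero
    (h.mem_subdiff (isGammaZero_conj hf.gammaZero ⟨u, hu⟩)) hu)

theorem IsLegendre.gateauxDifferentiableAt_conj (hf : IsLegendre f) {u : H}
    (hu : u ∈ interior (dom (conj f))) : GateauxDifferentiableAt (conj f) u := by
  have hu' := interior_subset hu
  have hg := isGammaZero_conj hf.gammaZero ⟨u, hu'⟩
  obtain ⟨p, -, hp⟩ := hg.exists_hasGateauxGradientAt hu fun p hp p' hp' =>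
    hf.eq_of_mem_subdiff (mem_subdiff_of_mem_subdiff_conj hf.gammaZero hp hu')
      (mem_subdiff_of_mem_subdiff_conj hf.gammaZero hp' hu')
  exact ⟨p, hp⟩

theorem IsLegendre.mem_gradImage_conj_iff (hf : IsLegendre f) {A : Set H} {p : H} :
    p ∈ gradImage (conj f) A ↔
      p ∈ interior (dom f) ∧ grad f p ∈ A ∧ HasGateauxGradientAt (conj f) (grad f p) p := by
  constructor
  · rintro ⟨u, ⟨huA, hu⟩, rfl⟩
    have h := hu.hasGateauxGradientAt
    have h' := hf.hasGateauxGradientAt_of_conj h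
    rw [h'.grad_eq]
    exact ⟨h'.1, huA, h⟩
  · rintro ⟨-, hA, h⟩
    exact ⟨grad f p, ⟨hA, p, h⟩, h.grad_eq⟩

theorem IsLegendre.mem_forwardPseudoCircumcenter_iff (hf : IsLegendre f) {S : Set H}
    (hS : S ⊆ dom f) {y p : H} (hy : y ∈ forwardE f S) :
    p ∈ forwardPseudoCircumcenter f S ↔ p ∈ gradImage (conj f) (affineSpan ℝ S : Set H) ∧
      grad f p - grad f y ∈ (affineSpan ℝ S).directionᗮ :=
  and_congr_right fun h =>
    mem_forwardE_iff hf.gammaZero hS hy (hf.mem_gradImage_conj_iff.1 h).1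

end
end Bregman

theorem theorem4p9 {H : Type*} [NormedAddCommGroup H] [InnerProductSpace ℝ H] [CompleteSpace H]
    (f : H → EReal) (hf : Bregman.IsLegendre f)
    (S : Set H) (hSfin : S.Finite) (hSne : S.Nonempty) (hSdom : S ⊆ Bregman.dom f)
    (y : H) (hy : y ∈ Bregman.forwardE f S) :
    -- the pseudo-circumcenter set as an intersection, where `M = aff S - aff S`
    Bregman.forwardPseudoCircumcenter f S =
        Bregman.gradImage (Bregman.conj f) (affineSpan ℝ S : Set H) ∩ interior (Bregman.dom f) ∩
          Bregman.gradImage (Bregman.conj f)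
            {u | ∃ w ∈ (affineSpan ℝ S).directionᗮ, u = Bregman.grad f y + w} ∧
    -- the projection `q` of `∇f(y)` onto `aff S` exists and is unique, and
    ∃ q, Bregman.bestApprox (affineSpan ℝ S : Set H) (Bregman.grad f y) = {q} ∧
      ((affineSpan ℝ S : Set H) ⊆ interior (Bregman.dom (Bregman.conj f)) ∨
          Bregman.dom (Bregman.conj f) = Set.univ →
        q ∈ interior (Bregman.dom (Bregman.conj f))) ∧
      (q ∈ interior (Bregman.dom (Bregman.conj f)) →
        Bregman.GateauxDifferentiableAt (Bregman.conj f) q ∧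
        Bregman.forwardPseudoCircumcenter f S = {Bregman.grad (Bregman.conj f) q}) := by
  constructor
  · ext p
    rw [hf.mem_forwardPseudoCircumcenter_iff hSdom hy]
    constructor
    · rintro ⟨hp, horth⟩
      have h := hf.mem_gradImage_conj_iff.1 hp
      exact ⟨⟨hp, h.1⟩, hf.mem_gradImage_conj_iff.2
        ⟨h.1, ⟨_, horth, (add_sub_cancel _ _).symm⟩, h.2.2⟩⟩
    · rintro ⟨⟨hp, -⟩, hp'⟩
      obtain ⟨w, hw, h⟩ := (hf.mem_gradImage_conj_iff.1 hp').2.1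
      refine ⟨hp, ?_⟩
      rwa [h, add_sub_cancel_left]
  · have : Nonempty (affineSpan ℝ S) := ((affineSpan_nonempty ℝ).2 hSne).to_subtype
    have : FiniteDimensional ℝ (affineSpan ℝ S).direction := by
      rw [direction_affineSpan]
      exact finiteDimensional_vectorSpan_of_finite ℝ hSfin
    let q : H := EuclideanGeometry.orthogonalProjection (affineSpan ℝ S) (Bregman.grad f y)
    have hqA : q ∈ affineSpan ℝ S := EuclideanGeometry.orthogonalProjection_mem _
    have hqo : Bregman.grad f y - q ∈ (affineSpan ℝ S).directionᗮ :=
      EuclideanGeometry.vsub_orthogonalProjection_mem_direction_orthogonal _ _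
    refine ⟨q, Bregman.bestApprox_eq_singleton hqA hqo, ?_, fun hq => ?_⟩
    · rintro (h | h)
      · exact h hqA
      · simp [h]
    have hdiff := hf.gateauxDifferentiableAt_conj hq
    refine ⟨hdiff, ?_⟩
    ext p
    rw [hf.mem_forwardPseudoCircumcenter_iff hSdom hy, Set.mem_singleton_iff]
    constructor
    · rintro ⟨hp, horth⟩
      obtain ⟨-, hpA, hgp⟩ := hf.mem_gradImage_conj_iff.1 hp
      -- `∇f(p) - q` lies in the direction of `aff S` and in its orthogonal complement.
      have h0 : Bregman.grad f p - q = 0 := by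
        refine (Submodule.orthogonal_disjoint (affineSpan ℝ S).direction).le_bot
          ⟨AffineSubspace.vsub_mem_direction hpA hqA, ?_⟩
        rw [← sub_add_sub_cancel _ (Bregman.grad f y)]
        exact add_mem horth hqo
      rw [sub_eq_zero.1 h0] at hgp
      exact hgp.grad_eq.symm
    · rintro rfl
      refine ⟨⟨q, ⟨hqA, hdiff⟩, rfl⟩, ?_⟩
      rw [(hf.hasGateauxGradientAt_of_conj hdiff.hasGateauxGradientAt).grad_eq, ← neg_sub]
      exact neg_mem hqo
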